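/- Let $G=(\Psi,\mathcal E)$ be a finite directed acyclic graph whose nodes are random variables (with values in standard Borel spaces). The nodes are divided into observables $X$ and parameters $\Theta=\Psi\setminus X$. Assume that the joint distribution of $\Psi$ has a density with respect to a product of $\sigma$-finite measures and satisfies the Markov factorization property $p(\Psi)=\prod_{\psi\in\Psi}p(\psi\mid\mathrm{pa}(\psi))$ with respect to $G$. For $X_I^\ast\subseteq X$, the module $\Psi_I$ generated by $X_I^\ast$ is the set consisting of $X_I^\ast$ and of the following nodes. For every directed path of $G$ (with at least one edge) whose final node (leaf) lies in $X_I^\ast$, list its nodes from the leaf backwards as $\psi_1,\psi_2,\dots,\psi_s$, so that $\psi_{i+1}\to\psi_i$ for $1\le i<s$. If the path meets $X\setminus X_I^\ast$, add $\psi_1,\dots,\psi_r$, where $\psi_r$ is the first node in this list that lies in $X\setminus X_I^\ast$; otherwise add the whole path $\psi_1,\dots,\psi_s$. Let $X=X_A^\ast\cup X_B^\ast\cup X_C^\ast$ be a partition of the observables into three pairwise disjoint sets, let $\Psi_A,\Psi_B,\Psi_C$ be the modules generated by $X_A^\ast,X_B^\ast,X_C^\ast$, and let $\Psi_T$ be the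 module generated by $X_T^\ast=X_B^\ast\cup X_C^\ast$. Put $$\Psi_{\underline{B}}=\Psi_B\setminus(\Psi_A\cup\Psi_C),\qquad \Psi_{\underline{C}}=\Psi_C\setminus(\Psi_A\cup\Psi_B),\qquad \Psi_{\underline{BC}}=(\Psi_B\cap\Psi_C)\setminus\Psi_A .$$ Then $\Psi_T=\Psi_B\cup\Psi_C$, and the following hold. 1. If $\Psi_{\underline{BC}}\neq\emptyset$, then there is at least one edge $a\to b$ of $G$ with $a\in\Psi_{\underline{BC}}$ and $b\in(\Psi_{\underline{B}}\cup X_B^\ast)\cup(\Psi_{\underline{C}}\cup X_C^\ast)$. 2. If $\Psi_{\underline{BC}}=\emptyset$, then $\Psi_{\underline{B}}$ and $\Psi_{\underline{C}}$ are conditionally independent given $\Psi_A$. -/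

import Mathlib

open MeasureTheory ProbabilityTheory
open scoped ENNReal

/-- A directed acyclic graph on the set of nodes `V`; `G.Adj a b` means that `a → b` is an edge. -/
structure DAG (V : Type*) extends Digraph V where
  acyclic : ∀ v : V, ¬ Relation.TransGen Adj v v

namespace DAG

variable {V : Type*}

/-- The parents of a node. -/
def parents (G : DAG V) (v : V) : Set V := {a | G.Adj a v}

/-- `p 0, p 1, …, p s` is a directed path listed from its leaf `p 0` back to its root `p s`,
so that the edges are `p (i + 1) → p i`; the values `p i` with `s < i` are irrelevant.
Leaf and root are distinct nodes, so there is at least one edge. -/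
def IsPathFromLeaf (G : DAG V) (p : ℕ → V) (s : ℕ) : Prop :=
  1 ≤ s ∧ ∀ i < s, G.Adj (p (i + 1)) (p i)

/-- The nodes which the directed path `p 0, …, p s` (listed from its leaf) contributes to the
module of `Xstar`, where `X` is the set of all observables: if the path meets `X \ Xstar`, its
initial piece up to and including the first node in `X \ Xstar`; otherwise the whole path. -/
def pathContribution (X Xstar : Set V) (p : ℕ → V) (s : ℕ) : Set V :=
  {v | (∃ r, 1 ≤ r ∧ r ≤ s ∧ p r ∈ X \ Xstar ∧ (∀ i < r, p i ∉ X \ Xstar) ∧ ∃ j ≤ r, p j = v) ∨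
    ((∀ i ≤ s, p i ∉ X \ Xstar) ∧ ∃ j ≤ s, p j = v)}

/-- The self-contained module generated by the set of observables `Xstar ⊆ X`: it consists of
`Xstar` together with the contributions of all directed paths whose leaf lies in `Xstar`. -/
def selfContainedModule (G : DAG V) (X Xstar : Set V) : Set V :=
  Xstar ∪ {v | ∃ (p : ℕ → V) (s : ℕ), G.IsPathFromLeaf p s ∧ p 0 ∈ Xstar ∧
    v ∈ pathContribution X Xstar p s}

/-- The joint distribution `P` of a family of variables indexed by the nodes of `G` has a density
with respect to the product of the reference measures `ν v`, and this density is
`∏ v, k v (x v ∣ x (pa v))` for conditional densities `k v` (the Markov factorization property). -/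
def MarkovFactorization [Fintype V] (G : DAG V) {E : V → Type*} [∀ v, MeasurableSpace (E v)]
    (ν : ∀ v, Measure (E v)) (P : Measure (∀ v, E v)) : Prop :=
  ∃ k : ∀ v : V, E v → (∀ u : G.parents v, E u) → ℝ≥0∞,
    (∀ v, Measurable (Function.uncurry (k v))) ∧
    (∀ v (y : ∀ u : G.parents v, E u), ∫⁻ t, k v t y ∂(ν v) = 1) ∧
    P = (Measure.pi ν).withDensity
      (fun x => ∏ v, k v (x v) ((G.parents v).domRestrict x))

end DAG

/-- Under the joint distribution `P` of the variables `(x v)`, the subfamilies indexed by `S` and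
`T` are conditionally independent given the subfamily indexed by `U`. -/
def CondIndepGiven {V : Type*} [Fintype V] {E : V → Type*} [∀ v, MeasurableSpace (E v)]
    [∀ v, StandardBorelSpace (E v)] (P : Measure (∀ v, E v)) [IsFiniteMeasure P]
    (S T U : Set V) : Prop :=
  CondIndepFun (MeasurableSpace.comap (U.domRestrict (π := E)) inferInstance)
    (measurable_pi_lambda _ fun u => measurable_pi_apply u.1).comap_le
    (S.domRestrict (π := E)) (T.domRestrict (π := E)) P

/-! A module contains all parents of each of its nodes that is a parameter or one of its own
generators; other observables only end paths. Both claims rest on this closure property.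

Overlap nonempty: choose a node `a` of `(B ∩ C) \ A` with no child in that set. It is not a
generator of both `B` and `C`, so in one of these modules it has a child that is a generator or a
parameter. A generator is already a valid target. A parameter cannot lie in `A`, since `A` would
then contain `a`, nor in the other module, by the choice of `a`.

Overlap empty: every node of `A ∪ B ∪ C` lies with its parents in `A ∪ (B \ (A ∪ C))` or in `A ∪ (C
\ (A ∪ B))`. Factors of nodes outside the modules integrate to one (`lmarginal_prod_factor`). The
remaining density is a product of two functions sharing only the variables of `A`, which gives
conditional independence (`condIndepGiven_of_density_eq_mul`). -/

section ConditionalIndependence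

/-- Conditional independence holds as soon as the conditional probability of `f ⁻¹' s` given both
`m` and `g` has an `m`-measurable version `β`. -/
theorem condIndepFun_of_exists_measurable {Ω F F' : Type*} {m mΩ : MeasurableSpace Ω}
    [StandardBorelSpace Ω] [MeasurableSpace F] [MeasurableSpace F'] (hm : m ≤ mΩ)
    (μ : Measure Ω) [IsFiniteMeasure μ] {f : Ω → F} {g : Ω → F'}
    (hf : Measurable f) (hg : Measurable g)
    (h : ∀ s, MeasurableSet s → ∃ β : Ω → ℝ≥0∞, Measurable[m] β ∧ (∀ x, β x ≤ 1) ∧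
      ∀ t D, MeasurableSet t → MeasurableSet[m] D →
        μ (f ⁻¹' s ∩ g ⁻¹' t ∩ D) = ∫⁻ x in g ⁻¹' t ∩ D, β x ∂μ) :
    CondIndepFun m hm f g μ := by
  rw [condIndepFun_iff_condExp_inter_preimage_eq_mul hf hg]
  intro s t hs ht
  obtain ⟨β, hβm, hβ1, hβ⟩ := h s hs
  have hβM : Measurable β := hβm.mono hm le_rfl
  have hβr : Measurable[m] fun x => (β x).toReal := hβm.ennreal_toReal
  have hβi : Integrable (fun x => (β x).toReal) μ := by
    refine Integrable.of_bound hβM.ennreal_toReal.aestronglyMeasurable 1 (.of_forall fun x => ?_)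
    rw [Real.norm_of_nonneg ENNReal.toReal_nonneg]
    exact ENNReal.toReal_le_of_le_ofReal zero_le_one (by simpa using hβ1 x)
  -- By the pull-out property the right side is the conditional expectation of `β` times the
  -- indicator of `g ⁻¹' t`; the hypothesis supplies the matching set integrals. The case `t = univ`
  -- later identifies `β` itself.
  have key : ∀ t, MeasurableSet t →
      μ⟦f ⁻¹' s ∩ g ⁻¹' t | m⟧ =ᵐ[μ] fun x => (β x).toReal * (μ⟦g ⁻¹' t | m⟧) x := by
    intro t ht
    have hst : MeasurableSet (f ⁻¹' s ∩ g ⁻¹' t) := (hf hs).inter (hg ht)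
    have hind : Integrable ((g ⁻¹' t).indicator fun _ => (1 : ℝ)) μ :=
      (integrable_const _).indicator (hg ht)
    have hprod : (fun x => (β x).toReal) * (g ⁻¹' t).indicator (fun _ => (1 : ℝ)) =
        (g ⁻¹' t).indicator fun x => (β x).toReal := by
      ext x
      by_cases hx : x ∈ g ⁻¹' t <;> simp [hx]
    have hpi : Integrable ((fun x => (β x).toReal) * (g ⁻¹' t).indicator (fun _ => (1 : ℝ))) μ := by
      rw [hprod]
      exact hβi.indicator (hg ht)
    have h1 := condExp_mul_of_stronglyMeasurable_left (m := m) hβr.stronglyMeasurable hpi hind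
    refine Filter.EventuallyEq.trans ?_ h1
    symm
    refine ae_eq_condExp_of_forall_setIntegral_eq hm ((integrable_const _).indicator hst)
      (fun _ _ _ => integrable_condExp.integrableOn) (fun D hD _ => ?_)
      stronglyMeasurable_condExp.aestronglyMeasurable
    rw [setIntegral_condExp hm hpi hD, hprod, integral_indicator (hg ht),
      Measure.restrict_restrict (hg ht), integral_indicator hst, Measure.restrict_restrict hst,
      integral_toReal hβM.aemeasurable
        (.of_forall fun x => (hβ1 x).trans_lt ENNReal.one_lt_top),
      ← hβ t D ht hD]
    simp [Measure.real]
  have hs' : μ⟦f ⁻¹' s | m⟧ =ᵐ[μ] fun x => (β x).toReal := by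
    have := key Set.univ MeasurableSet.univ
    simp only [Set.preimage_univ, Set.inter_univ, Set.indicator_univ, condExp_const hm,
      mul_one] at this
    exact this
  filter_upwards [key t ht, hs'] with x h1 h2
  rw [h1, h2]

end ConditionalIndependence

/-! ### Iterated integration over groups of coordinates. -/

section Marginals

variable {V : Type*} {E : V → Type*}

theorem DependsOn.mul {M : Type*} [Mul M] {f g : (∀ v, E v) → M} {s : Set V}
    (hf : DependsOn f s) (hg : DependsOn g s) : DependsOn (f * g) s :=
  fun x y h => by simp [hf h, hg h]

theorem dependsOn_indicator_preimage_domRestrict {U : Set V} (s : Set (∀ u : U, E u)) :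
    DependsOn ((U.domRestrict ⁻¹' s).indicator (1 : (∀ v, E v) → ℝ≥0∞)) U := fun x y h => by
  have h' : x ∈ U.domRestrict ⁻¹' s ↔ y ∈ U.domRestrict ⁻¹' s := by
    rw [Set.mem_preimage, Set.mem_preimage, Set.dependsOn_domRestrict U h]
  by_cases hx : x ∈ U.domRestrict ⁻¹' s
  · rw [Set.indicator_of_mem hx, Set.indicator_of_mem (h'.1 hx)]
    rfl
  · rw [Set.indicator_of_notMem hx, Set.indicator_of_notMem fun hy => hx (h'.2 hy)]

variable [∀ v, MeasurableSpace (E v)]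

/-- Filling the coordinates outside `U` with those of `x₀` makes `f` factor measurably through
restriction to `U`. -/
theorem Measurable.comap_domRestrict_of_dependsOn {β : Type*} [MeasurableSpace β]
    {f : (∀ v, E v) → β} (hf : Measurable f) {U : Set V} (hU : DependsOn f U) (x₀ : ∀ v, E v) :
    Measurable[MeasurableSpace.comap (U.domRestrict (π := E)) inferInstance] f := by
  classical
  let e : (∀ u : U, E u) → ∀ v, E v := fun y v => if h : v ∈ U then y ⟨v, h⟩ else x₀ v
  have he : Measurable e := by
    refine measurable_pi_lambda _ fun v => ?_
    by_cases h : v ∈ U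
    · simpa only [e, h, dite_true] using measurable_pi_apply (⟨v, h⟩ : U)
    · simp only [e, h, dite_false, measurable_const]
  have hfe : f = (f ∘ e) ∘ U.domRestrict := by
    ext x
    refine hU fun v hv => ?_
    simp [e, hv, Set.domRestrict]
  rw [hfe]
  exact (hf.comp he).comp (comap_measurable _)

variable [DecidableEq V] (ν : ∀ v, Measure (E v))

theorem lmarginal_mul_of_dependsOn {s : Finset V} {φ f : (∀ v, E v) → ℝ≥0∞}
    (hφ : DependsOn φ (s : Set V)ᶜ) (hf : Measurable f) :
    lmarginal ν s (φ * f) = φ * lmarginal ν s f := by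
  ext x
  have h (y) : φ (Function.updateFinset x s y) = φ x :=
    hφ fun i hi => by simp [Function.updateFinset, show i ∉ s from hi]
  simp only [lmarginal, Pi.mul_apply, h]
  exact lintegral_const_mul _ (hf.comp measurable_updateFinset)

theorem dependsOn_lmarginal {s : Finset V} {D : Set V} {f : (∀ v, E v) → ℝ≥0∞}
    (hf : DependsOn f (D ∪ s)) : DependsOn (lmarginal ν s f) D := by
  intro x y h
  simp only [lmarginal]
  refine lintegral_congr fun z => hf fun i hi => ?_
  by_cases his : i ∈ s
  · simp [Function.updateFinset, his]
  · simpa [Function.updateFinset, his] using h i (hi.resolve_right his)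

variable [∀ v, SigmaFinite (ν v)]

/-- Iterated integration against a density that factorizes into a part on `A ∪ S`, a part on
`A ∪ T` and a part whose integral over the remaining coordinates `W` is one. -/
theorem lintegral_pi_mul_of_factorization [Fintype V] {A S T W : Finset V}
    (hAS : Disjoint A S) (hAT : Disjoint A T) (hST : Disjoint S T)
    (hW : W = (A ∪ S ∪ T)ᶜ) {φ f g h : (∀ v, E v) → ℝ≥0∞}
    (hφm : Measurable φ) (hfm : Measurable f) (hgm : Measurable g) (hhm : Measurable h)
    (hφ : DependsOn φ A) (hf : DependsOn f (A ∪ S)) (hg : DependsOn g (A ∪ T))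
    (hh : lmarginal ν W h = 1) (x₀ : ∀ v, E v) :
    ∫⁻ x, (φ * f * g * h) x ∂Measure.pi ν =
      lmarginal ν A (φ * lmarginal ν S f * lmarginal ν T g) x₀ := by
  have huniv : (Finset.univ : Finset V) = A ∪ (S ∪ (T ∪ W)) := by
    subst hW
    ext v
    simp only [Finset.mem_univ, Finset.mem_union, Finset.mem_compl, true_iff]
    tauto
  have hdisj : Disjoint A W ∧ Disjoint S W ∧ Disjoint T W := by
    subst hW
    simp only [Finset.disjoint_left, Finset.mem_compl, Finset.mem_union]
    exact ⟨fun _ h => by tauto, fun _ h => by tauto, fun _ h => by tauto⟩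
  obtain ⟨hAW, hSW, hTW⟩ := hdisj
  have sub {D : Set V} {F : Finset V} (h : ∀ v ∈ D, v ∉ F) : D ⊆ (F : Set V)ᶜ := h
  rw [Finset.disjoint_left] at hAS hAT hST hAW hSW hTW
  have dφ {F : Finset V} (hF : ∀ v ∈ A, v ∉ F) : DependsOn φ (F : Set V)ᶜ :=
    hφ.mono (sub hF)
  have df {F : Finset V} (hF : ∀ v ∈ A, v ∉ F) (hF' : ∀ v ∈ S, v ∉ F) :
      DependsOn f (F : Set V)ᶜ := hf.mono (sub fun v hv => hv.elim (hF v) (hF' v))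
  have dg {F : Finset V} (hF : ∀ v ∈ A, v ∉ F) (hF' : ∀ v ∈ T, v ∉ F) :
      DependsOn g (F : Set V)ᶜ := hg.mono (sub fun v hv => hv.elim (hF v) (hF' v))
  have dG : DependsOn (lmarginal ν T g) A := dependsOn_lmarginal ν hg
  have hm : Measurable (φ * f * g * h) := ((hφm.mul hfm).mul hgm).mul hhm
  have iW : lmarginal ν W (φ * f * g * h) = φ * f * g := by
    rw [lmarginal_mul_of_dependsOn ν
      (((dφ hAW).mul (df hAW hSW)).mul (dg hAW hTW)) hhm, hh, mul_one]
  have iT : lmarginal ν T (φ * f * g) = φ * f * lmarginal ν T g :=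
    lmarginal_mul_of_dependsOn ν ((dφ hAT).mul (df hAT hST)) hgm
  have iS : lmarginal ν S (φ * f * lmarginal ν T g) =
      φ * lmarginal ν S f * lmarginal ν T g := by
    rw [mul_right_comm, lmarginal_mul_of_dependsOn ν
      ((dφ hAS).mul (dG.mono (sub hAS))) hfm, mul_right_comm]
  rw [lintegral_eq_lmarginal_univ x₀, huniv, lmarginal_union ν _ hm, lmarginal_union ν _ hm,
    lmarginal_union ν _ hm, iW, iT, iS]
  · exact Finset.disjoint_left.2 hTW
  · rw [Finset.disjoint_union_right]
    exact ⟨Finset.disjoint_left.2 hST, Finset.disjoint_left.2 hSW⟩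
  · rw [Finset.disjoint_union_right, Finset.disjoint_union_right]
    exact ⟨Finset.disjoint_left.2 hAS, Finset.disjoint_left.2 hAT, Finset.disjoint_left.2 hAW⟩

end Marginals

/-- Cancelling `b` fails only at `0` and `∞`. The first forces `a = 0`; the second forces `d = 0`,
hence `c = 0`. -/
theorem ENNReal.div_mul_mul_eq_of_le {a b c d : ℝ≥0∞} (hab : a ≤ b) (hcd : c ≤ d)
    (h : b * d ≠ ∞) : a / b * b * c = a * c := by
  rcases eq_or_ne b 0 with rfl | hb
  · simp [nonpos_iff_eq_zero.1 hab]
  rcases eq_or_ne b ∞ with rfl | hb'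
  · have hd : d = 0 := by
      by_contra hd
      exact h (ENNReal.top_mul hd)
    simp [nonpos_iff_eq_zero.1 (hd ▸ hcd)]
  · rw [ENNReal.div_mul_cancel hb hb']

/-- If the joint density of the variables factorizes as `f g h`, where `f` only involves the
variables in `U ∪ S`, `g` only those in `U ∪ T`, and `h` integrates to one over the remaining
variables, then the variables in `S` and in `T` are conditionally independent given those
in `U`. -/
theorem condIndepGiven_of_density_eq_mul {V : Type*} [Fintype V] [DecidableEq V] {E : V → Type*}
    [∀ v, MeasurableSpace (E v)] [∀ v, StandardBorelSpace (E v)]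
    (ν : ∀ v, Measure (E v)) [∀ v, SigmaFinite (ν v)]
    (P : Measure (∀ v, E v)) [IsProbabilityMeasure P] {U S T W : Finset V}
    (hUS : Disjoint U S) (hUT : Disjoint U T) (hST : Disjoint S T)
    (hW : W = (U ∪ S ∪ T)ᶜ) {f g h : (∀ v, E v) → ℝ≥0∞}
    (hfm : Measurable f) (hgm : Measurable g) (hhm : Measurable h)
    (hf : DependsOn f (U ∪ S)) (hg : DependsOn g (U ∪ T)) (hh : lmarginal ν W h = 1)
    (hP : P = (Measure.pi ν).withDensity (f * g * h)) :
    CondIndepGiven P (S : Set V) T U := by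
  obtain ⟨x₀⟩ : Nonempty (∀ v, E v) := nonempty_of_isProbabilityMeasure P
  have mr (s : Set V) : Measurable (s.domRestrict (π := E)) :=
    measurable_pi_lambda _ fun u => measurable_pi_apply u.1
  have hdm : Measurable (f * g * h) := (hfm.mul hgm).mul hhm
  have hint {φ b c : (∀ v, E v) → ℝ≥0∞} (hφm : Measurable φ) (hbm : Measurable b)
      (hcm : Measurable c) (hφ : DependsOn φ U) (hb : DependsOn b S) (hc : DependsOn c T) :
      ∫⁻ x, φ x * b x * c x ∂P =
        lmarginal ν U (φ * lmarginal ν S (b * f) * lmarginal ν T (c * g)) x₀ := by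
    rw [← lintegral_pi_mul_of_factorization ν hUS hUT hST hW hφm (hbm.mul hfm) (hcm.mul hgm) hhm hφ
      ((hb.mono Set.subset_union_right).mul hf) ((hc.mono Set.subset_union_right).mul hg) hh x₀,
      hP]
    refine (lintegral_withDensity_eq_lintegral_mul _ hdm ((hφm.mul hbm).mul hcm)).trans ?_
    refine lintegral_congr fun x => ?_
    simp only [Pi.mul_apply]
    ring
  set F₁ := lmarginal ν S f with hF₁
  set G₁ := lmarginal ν T g with hG₁
  have hF₁m : Measurable F₁ := hfm.lmarginal ν
  have hG₁m : Measurable G₁ := hgm.lmarginal ν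
  -- This integral is the total mass of `P`. Hence `F₁ * G₁` is finite almost everywhere in the
  -- `U`-coordinates, which permits the cancellation of `F₁` at the end.
  have hfin : lmarginal ν U (F₁ * G₁) x₀ ≠ ∞ := by
    have := hint (φ := 1) (b := 1) (c := 1) measurable_one measurable_one measurable_one
      (fun _ _ _ => rfl) (fun _ _ _ => rfl) (fun _ _ _ => rfl)
    simp only [one_mul, Pi.one_apply, lintegral_const, measure_univ] at this
    rw [← this]
    exact ENNReal.one_ne_top
  have hae : ∀ᵐ y ∂(Measure.pi fun i : U => ν i),
      (F₁ * G₁) (Function.updateFinset x₀ U y) < ∞ :=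
    ae_lt_top ((hF₁m.mul hG₁m).comp measurable_updateFinset) hfin
  refine condIndepFun_of_exists_measurable _ P (mr _) (mr _) fun s hs => ?_
  let b : (∀ v, E v) → ℝ≥0∞ := ((S : Set V).domRestrict ⁻¹' s).indicator 1
  have hbm : Measurable b := measurable_one.indicator (mr _ hs)
  have hb : DependsOn b S := dependsOn_indicator_preimage_domRestrict _
  -- The candidate conditional probability of the event `s` given the `U`-variables is `F / F₁`: the
  -- integral of `f` over the event, divided by its full integral.
  set F := lmarginal ν S (b * f) with hF
  have hFm : Measurable F := (hbm.mul hfm).lmarginal ν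
  have hFle (x) : F x ≤ F₁ x := by
    refine lmarginal_mono (fun y => ?_) x
    refine mul_le_of_le_one_left' ?_
    exact Set.indicator_le_self' (fun _ _ => zero_le) y
  have hFU : DependsOn F U :=
    dependsOn_lmarginal ν ((hb.mono Set.subset_union_right).mul hf)
  have hF₁U : DependsOn F₁ U := dependsOn_lmarginal ν hf
  have hβU : DependsOn (fun x => F x / F₁ x) U := fun x y hxy => by simp only [hFU hxy, hF₁U hxy]
  have hβm : Measurable fun x => F x / F₁ x := hFm.div hF₁m
  refine ⟨fun x => F x / F₁ x, hβm.comap_domRestrict_of_dependsOn hβU x₀,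
    fun x => ENNReal.div_le_of_le_mul (by simpa using hFle x), fun t D ht hD => ?_⟩
  obtain ⟨D, hD, rfl⟩ := hD
  let c : (∀ v, E v) → ℝ≥0∞ := ((T : Set V).domRestrict ⁻¹' t).indicator 1
  have hcm : Measurable c := measurable_one.indicator (mr _ ht)
  have hc : DependsOn c T := dependsOn_indicator_preimage_domRestrict _
  let φ : (∀ v, E v) → ℝ≥0∞ := ((U : Set V).domRestrict ⁻¹' D).indicator 1
  have hφm : Measurable φ := measurable_one.indicator (mr _ hD)
  have hφ : DependsOn φ U := dependsOn_indicator_preimage_domRestrict _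
  have hGle (x) : lmarginal ν T (c * g) x ≤ G₁ x := by
    refine lmarginal_mono (fun y => ?_) x
    refine mul_le_of_le_one_left' ?_
    exact Set.indicator_le_self' (fun _ _ => zero_le) y
  have lhs : P ((S : Set V).domRestrict ⁻¹' s ∩ (T : Set V).domRestrict ⁻¹' t ∩
      (U : Set V).domRestrict ⁻¹' D) = ∫⁻ x, φ x * b x * c x ∂P := by
    rw [← lintegral_indicator_one (((mr _ hs).inter (mr _ ht)).inter (mr _ hD))]
    refine lintegral_congr fun x => ?_
    rw [Set.inter_indicator_one, Set.inter_indicator_one]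
    simp only [φ, b, c, Pi.mul_apply]
    ring
  have rhs : ∫⁻ x in (T : Set V).domRestrict ⁻¹' t ∩ (U : Set V).domRestrict ⁻¹' D,
      F x / F₁ x ∂P = ∫⁻ x, (φ * fun x => F x / F₁ x) x * (1 : (∀ v, E v) → ℝ≥0∞) x * c x ∂P := by
    rw [← lintegral_indicator ((mr _ ht).inter (mr _ hD))]
    refine lintegral_congr fun x => ?_
    have hmul (Q : Set (∀ v, E v)) (u : (∀ v, E v) → ℝ≥0∞) :
        Q.indicator u x = Q.indicator 1 x * u x := by
      by_cases hx : x ∈ Q <;> simp [hx]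
    rw [hmul, Set.inter_indicator_one]
    simp only [φ, c, Pi.mul_apply, Pi.one_apply]
    ring
  rw [lhs, rhs, hint hφm hbm hcm hφ hb hc,
    hint (hφm.mul hβm) measurable_one hcm (hφ.mul hβU) (fun _ _ _ => rfl) hc, one_mul]
  refine lintegral_congr_ae ?_
  filter_upwards [hae] with y hy
  simp only [Pi.mul_apply] at hy ⊢
  have := ENNReal.div_mul_mul_eq_of_le (hFle (Function.updateFinset x₀ U y))
    (hGle (Function.updateFinset x₀ U y)) hy.ne
  rw [mul_assoc, ← hF, ← this, ← hF₁]
  ring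

namespace DAG

/-! ### Sinks in finite acyclic graphs. -/

section Sinks

variable {V : Type*} [Finite V] (G : DAG V)

theorem wellFounded_swap_transGen : WellFounded (Function.swap (Relation.TransGen G.Adj)) :=
  have : Std.Irrefl (Function.swap (Relation.TransGen G.Adj)) := ⟨G.acyclic⟩
  Finite.wellFounded_of_trans_of_irrefl _

/-- A nonempty set of nodes of a directed acyclic graph has an element without children in it. -/
theorem exists_sink {s : Set V} (hs : s.Nonempty) : ∃ a ∈ s, ∀ b ∈ s, ¬ G.Adj a b := by
  obtain ⟨a, ha, h⟩ := G.wellFounded_swap_transGen.has_min s hs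
  exact ⟨a, ha, fun b hb hab => h b hb (.single hab)⟩

end Sinks

/-! ### Conditional independence from the Markov factorization. -/

section Factorization

variable {V : Type*} {G : DAG V} {E : V → Type*}
  {k : ∀ v : V, E v → (∀ u : G.parents v, E u) → ℝ≥0∞}

theorem dependsOn_factor (v : V) :
    DependsOn (fun x : ∀ v, E v => k v (x v) ((G.parents v).domRestrict x))
      (insert v (G.parents v)) := fun x y h => by
  have h' : (G.parents v).domRestrict x = (G.parents v).domRestrict y :=
    Set.dependsOn_domRestrict _ fun i hi => h i (Set.mem_insert_of_mem _ hi)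
  simp only [h v (Set.mem_insert _ _), h']

theorem dependsOn_prod_factor {s : Finset V} {D : Set V}
    (h : ∀ v ∈ s, insert v (G.parents v) ⊆ D) :
    DependsOn (fun x : ∀ v, E v => ∏ v ∈ s, k v (x v) ((G.parents v).domRestrict x)) D :=
  fun _ _ hxy => Finset.prod_congr rfl fun v hv => (dependsOn_factor v).mono (h v hv) hxy

variable [∀ v, MeasurableSpace (E v)] {ν : ∀ v, Measure (E v)}

theorem measurable_factor (hk : ∀ v, Measurable (Function.uncurry (k v))) (v : V) :
    Measurable fun x : ∀ v, E v => k v (x v) ((G.parents v).domRestrict x) :=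
  (hk v).comp ((measurable_pi_apply v).prodMk
    (measurable_pi_lambda _ fun u => measurable_pi_apply u.1))

/-- Integrating a product of conditional densities over the variables they belong to
gives one. -/
theorem lmarginal_prod_factor [Fintype V] [DecidableEq V] [∀ v, SigmaFinite (ν v)]
    (hk : ∀ v, Measurable (Function.uncurry (k v)))
    (hk1 : ∀ v (y : ∀ u : G.parents v, E u), ∫⁻ t, k v t y ∂(ν v) = 1) (W : Finset V) :
    lmarginal ν W (fun x => ∏ v ∈ W, k v (x v) ((G.parents v).domRestrict x)) = 1 := by
  induction W using Finset.strongInduction with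
  | H W ih =>
    rcases W.eq_empty_or_nonempty with rfl | hne
    · simp only [lmarginal_empty, Finset.prod_empty]
      rfl
    -- No other factor in `W` involves the variable of a sink `w`, so it can be integrated out
    -- first.
    obtain ⟨w, hw, hmax⟩ := G.exists_sink (s := (W : Set V)) hne
    have hself (v : V) : ¬ G.Adj v v := fun h => G.acyclic v (.single h)
    rw [lmarginal_erase' _ (Finset.measurable_prod _ fun v _ => measurable_factor hk v) hw,
      ← ih _ (Finset.erase_ssubset hw)]
    congr 1
    ext x
    have hrest (t : E w) : ∏ v ∈ W, k v (Function.update x w t v)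
        ((G.parents v).domRestrict (Function.update x w t)) =
        k w t ((G.parents w).domRestrict x) *
          ∏ v ∈ W.erase w, k v (x v) ((G.parents v).domRestrict x) := by
      rw [← Finset.mul_prod_erase _ _ hw]
      congr 1
      · have h' : (G.parents w).domRestrict (Function.update x w t) =
            (G.parents w).domRestrict x :=
          Set.dependsOn_domRestrict _ fun i hi =>
            Function.update_of_ne (by rintro rfl; exact hself _ hi) _ _
        rw [h', Function.update_self]
      · refine Finset.prod_congr rfl fun v hv' => ?_
        have hvw := Finset.ne_of_mem_erase hv'
        refine dependsOn_factor v fun i hi => Function.update_of_ne ?_ _ _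
        rintro rfl
        exact hi.elim (fun h => hvw h.symm) (hmax v (Finset.mem_of_mem_erase hv'))
    simp only [hrest]
    have hkw : Measurable fun t => k w t ((G.parents w).domRestrict x) :=
      (hk w).comp (measurable_id.prodMk measurable_const)
    rw [lintegral_mul_const _ hkw, hk1, one_mul]

/-- If every node of `A ∪ S ∪ T` lies together with its parents in `A ∪ S` or in `A ∪ T`, then
`S` and `T` are conditionally independent given `A`. -/
theorem MarkovFactorization.condIndepGiven [Fintype V] [∀ v, StandardBorelSpace (E v)]
    [∀ v, SigmaFinite (ν v)] {P : Measure (∀ v, E v)} [IsProbabilityMeasure P]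
    (hP : G.MarkovFactorization ν P) {A S T : Set V} (hAS : Disjoint A S) (hAT : Disjoint A T)
    (hST : Disjoint S T)
    (h : ∀ v ∈ A ∪ S ∪ T, insert v (G.parents v) ⊆ A ∪ S ∨ insert v (G.parents v) ⊆ A ∪ T) :
    CondIndepGiven P S T A := by
  classical
  obtain ⟨k, hk, hk1, hPk⟩ := hP
  lift A to Finset V using A.toFinite
  lift S to Finset V using S.toFinite
  lift T to Finset V using T.toFinite
  let k' (v : V) (x : ∀ v, E v) : ℝ≥0∞ := k v (x v) ((G.parents v).domRestrict x)
  -- A family contained in `A` fits on both sides; splitting by a condition and its negation uses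
  -- each factor once.
  let I : Finset V := {v ∈ A ∪ S ∪ T | insert v (G.parents v) ⊆ (A : Set V) ∪ S}
  let J : Finset V := {v ∈ A ∪ S ∪ T | ¬ insert v (G.parents v) ⊆ (A : Set V) ∪ S}
  have hm (s : Finset V) : Measurable fun x => ∏ v ∈ s, k' v x :=
    Finset.measurable_prod _ fun v _ => measurable_factor hk v
  refine condIndepGiven_of_density_eq_mul ν P (Finset.disjoint_coe.1 hAS)
    (Finset.disjoint_coe.1 hAT) (Finset.disjoint_coe.1 hST) rfl (hm I) (hm J)
    (hm (A ∪ S ∪ T)ᶜ) (dependsOn_prod_factor fun v hv => (Finset.mem_filter.1 hv).2)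
    (dependsOn_prod_factor fun v hv => ?_) (lmarginal_prod_factor hk hk1 _) ?_
  · obtain ⟨hv, hv'⟩ := Finset.mem_filter.1 hv
    exact (h v (by simpa [or_assoc] using hv)).resolve_left hv'
  · rw [hPk]
    congr 1
    ext x
    simp only [Pi.mul_apply, I, J]
    rw [Finset.prod_filter_mul_prod_filter_not, Finset.prod_mul_prod_compl]

end Factorization

/-! ### Closure properties of modules. -/

section Modules

variable {V : Type*} {G : DAG V} {X Y Z : Set V}

theorem subset_selfContainedModule : Y ⊆ G.selfContainedModule X Y := Set.subset_union_left

/-- A node belongs to the module of `Y` if and only if it starts a possibly trivial directed path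
into `Y` whose later nodes avoid `X \ Y`. -/
theorem mem_selfContainedModule_iff {v : V} :
    v ∈ G.selfContainedModule X Y ↔
      ∃ (p : ℕ → V) (s : ℕ), p 0 ∈ Y ∧ p s = v ∧ ∀ i < s, G.Adj (p (i + 1)) (p i) ∧
        p i ∉ X \ Y := by
  constructor
  · rintro (hv | ⟨p, s, ⟨-, hp⟩, h0, ⟨r, -, hrs, -, hr, j, hj, rfl⟩ | ⟨hs, j, hj, rfl⟩⟩)
    · exact ⟨fun _ => v, 0, hv, rfl, by simp⟩
    · exact ⟨p, j, h0, rfl, fun i hi => ⟨hp i (by lia), hr i (by lia)⟩⟩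
    · exact ⟨p, j, h0, rfl, fun i hi => ⟨hp i (by lia), hs i (by lia)⟩⟩
  · rintro ⟨p, s, h0, rfl, h⟩
    rcases Nat.eq_zero_or_pos s with rfl | hs
    · exact .inl h0
    refine .inr ⟨p, s, ⟨hs, fun i hi => (h i hi).1⟩, h0, ?_⟩
    by_cases hX : p s ∈ X \ Y
    · exact .inl ⟨s, hs, le_rfl, hX, fun i hi => (h i hi).2, s, le_rfl, rfl⟩
    · refine .inr ⟨fun i hi => ?_, s, le_rfl, rfl⟩
      rcases hi.lt_or_eq with hi | rfl
      exacts [(h i hi).2, hX]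

/-- A module contains the parents of its nodes that are parameters or generators. -/
theorem mem_selfContainedModule_of_adj {a b : V} (hb : b ∈ G.selfContainedModule X Y)
    (hbX : b ∉ X \ Y) (hab : G.Adj a b) : a ∈ G.selfContainedModule X Y := by
  rw [mem_selfContainedModule_iff] at hb ⊢
  obtain ⟨p, s, h0, rfl, h⟩ := hb
  refine ⟨fun i => if i ≤ s then p i else a, s + 1, by simpa using h0, by simp, fun i hi => ?_⟩
  rcases (Nat.lt_succ_iff.1 hi).lt_or_eq with hi | rfl
  · simpa [hi.le, Nat.succ_le_of_lt hi] using h i hi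
  · simpa using ⟨hab, by simpa using hbX⟩

/-- Induction along the paths generating a module. -/
theorem selfContainedModule_subset {M : Set V} (hY : Y ⊆ M)
    (hM : ∀ a b, b ∈ G.selfContainedModule X Y → b ∈ M → b ∉ X \ Y → G.Adj a b → a ∈ M) :
    G.selfContainedModule X Y ⊆ M := by
  intro v hv
  obtain ⟨p, s, h0, rfl, h⟩ := mem_selfContainedModule_iff.1 hv
  clear hv
  induction s with
  | zero => exact hY h0
  | succ s ih =>
    exact hM _ (p s)
      (mem_selfContainedModule_iff.2 ⟨p, s, h0, rfl, fun i hi => h i (by lia)⟩)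
      (ih fun i hi => h i (by lia)) (h s (by lia)).2 (h s (by lia)).1

/-- A node of a module that is not a generator has a child in the module that is a generator
or a parameter. -/
theorem exists_adj_of_mem_selfContainedModule {v : V} (hv : v ∈ G.selfContainedModule X Y)
    (hvY : v ∉ Y) : ∃ b ∈ G.selfContainedModule X Y, b ∉ X \ Y ∧ G.Adj v b := by
  have := selfContainedModule_subset (G := G) (X := X) (Y := Y)
    (M := {v | v ∉ Y → ∃ b ∈ G.selfContainedModule X Y, b ∉ X \ Y ∧ G.Adj v b})
    (fun v hv h => (h hv).elim) (fun a b hb _ hbX hab _ => ⟨b, hb, hbX, hab⟩)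
  exact this hv hvY

theorem selfContainedModule_mono (hYZ : Y ⊆ Z) :
    G.selfContainedModule X Y ⊆ G.selfContainedModule X Z :=
  selfContainedModule_subset (hYZ.trans subset_selfContainedModule) fun _ _ _ hbZ hbX hab =>
    mem_selfContainedModule_of_adj hbZ (fun h => hbX ⟨h.1, fun h' => h.2 (hYZ h')⟩) hab

/-- An observable of `Z` blocks paths into `Y` for the module of `Y` alone, but it generates the
module of `Z`, so the path restarts there. -/
theorem selfContainedModule_union :
    G.selfContainedModule X (Y ∪ Z) = G.selfContainedModule X Y ∪ G.selfContainedModule X Z := by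
  refine Set.Subset.antisymm (selfContainedModule_subset
    (Set.union_subset_union subset_selfContainedModule subset_selfContainedModule) ?_)
    (Set.union_subset (selfContainedModule_mono Set.subset_union_left)
      (selfContainedModule_mono Set.subset_union_right))
  intro a b _ hb hbX hab
  by_cases hbY : b ∈ Y
  · exact .inl (mem_selfContainedModule_of_adj (subset_selfContainedModule hbY)
      (fun h => h.2 hbY) hab)
  by_cases hbZ : b ∈ Z
  · exact .inr (mem_selfContainedModule_of_adj (subset_selfContainedModule hbZ)
      (fun h => h.2 hbZ) hab)
  have hbX' : b ∉ X := fun h => hbX ⟨h, fun h' => h'.elim hbY hbZ⟩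
  exact hb.imp (mem_selfContainedModule_of_adj · (fun h => hbX' h.1) hab)
    (mem_selfContainedModule_of_adj · (fun h => hbX' h.1) hab)

end Modules

end DAG

/-! ### Edges out of the overlap, and independence without overlap. -/

theorem lemma4 {V : Type*} [Fintype V] (G : DAG V)
    {E : V → Type*} [∀ v, MeasurableSpace (E v)] [∀ v, StandardBorelSpace (E v)]
    (ν : ∀ v, Measure (E v)) [∀ v, SigmaFinite (ν v)]
    (P : Measure (∀ v, E v)) [IsProbabilityMeasure P] (hP : G.MarkovFactorization ν P)
    (X XA XB XC : Set V) (hX : XA ∪ XB ∪ XC = X)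
    (hAB : Disjoint XA XB) (hAC : Disjoint XA XC) (hBC : Disjoint XB XC)
    (A B C T : Set V)
    (hA : A = G.selfContainedModule X XA) (hB : B = G.selfContainedModule X XB)
    (hC : C = G.selfContainedModule X XC) (hT : T = G.selfContainedModule X (XB ∪ XC)) :
    T = B ∪ C ∧
    (((B ∩ C) \ A).Nonempty →
      ∃ a ∈ (B ∩ C) \ A, ∃ b ∈ ((B \ (A ∪ C)) ∪ XB) ∪ ((C \ (A ∪ B)) ∪ XC), G.Adj a b) ∧
    ((B ∩ C) \ A = ∅ → CondIndepGiven P (B \ (A ∪ C)) (C \ (A ∪ B)) A) := by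
  have parA {a b : V} (hb : b ∈ A) (hbX : b ∉ X \ XA) (hab : G.Adj a b) : a ∈ A := by
    subst hA
    exact DAG.mem_selfContainedModule_of_adj hb hbX hab
  have parB {a b : V} (hb : b ∈ B) (hbX : b ∉ X \ XB) (hab : G.Adj a b) : a ∈ B := by
    subst hB
    exact DAG.mem_selfContainedModule_of_adj hb hbX hab
  have parC {a b : V} (hb : b ∈ C) (hbX : b ∉ X \ XC) (hab : G.Adj a b) : a ∈ C := by
    subst hC
    exact DAG.mem_selfContainedModule_of_adj hb hbX hab
  have hXA : XA ⊆ A := hA ▸ DAG.subset_selfContainedModule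
  have hXB : XB ⊆ B := hB ▸ DAG.subset_selfContainedModule
  have hXC : XC ⊆ C := hC ▸ DAG.subset_selfContainedModule
  refine ⟨by rw [hT, hB, hC, DAG.selfContainedModule_union], fun hne => ?_, fun hempty => ?_⟩
  · obtain ⟨a, ha, hmax⟩ := G.exists_sink hne
    refine ⟨a, ha, ?_⟩
    obtain ⟨⟨haB, haC⟩, haA⟩ := ha
    by_cases haXB : a ∈ XB
    · obtain ⟨b, hb, hbX, hab⟩ := DAG.exists_adj_of_mem_selfContainedModule (hC ▸ haC)
        (Set.disjoint_left.1 hBC haXB)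
      rw [← hC] at hb
      refine ⟨b, .inr ?_, hab⟩
      by_cases hbXC : b ∈ XC
      · exact .inr hbXC
      have hbA : b ∉ A := fun h => haA (parA h (fun h' => hbX ⟨h'.1, hbXC⟩) hab)
      exact .inl ⟨hb, fun h => h.elim hbA fun hbB => hmax b ⟨⟨hbB, hb⟩, hbA⟩ hab⟩
    · obtain ⟨b, hb, hbX, hab⟩ := DAG.exists_adj_of_mem_selfContainedModule (hB ▸ haB) haXB
      rw [← hB] at hb
      refine ⟨b, .inl ?_, hab⟩
      by_cases hbXB : b ∈ XB
      · exact .inr hbXB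
      have hbA : b ∉ A := fun h => haA (parA h (fun h' => hbX ⟨h'.1, hbXB⟩) hab)
      exact .inl ⟨hb, fun h => h.elim hbA fun hbC => hmax b ⟨⟨hb, hbC⟩, hbA⟩ hab⟩
  · have hsub : ∀ v, v ∈ B → v ∈ C → v ∈ A := fun v hvB hvC => by
      by_contra hvA
      exact (hempty ▸ (⟨⟨hvB, hvC⟩, hvA⟩ : v ∈ (B ∩ C) \ A) : v ∈ (∅ : Set V))
    have hBS : B ⊆ A ∪ B \ (A ∪ C) := fun v hv => by
      by_cases hvA : v ∈ A
      · exact .inl hvA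
      · exact .inr ⟨hv, fun h => h.elim hvA fun hvC => hvA (hsub v hv hvC)⟩
    have hCT : C ⊆ A ∪ C \ (A ∪ B) := fun v hv => by
      by_cases hvA : v ∈ A
      · exact .inl hvA
      · exact .inr ⟨hv, fun h => h.elim hvA fun hvB => hvA (hsub v hvB hv)⟩
    have famA {v : V} (hv : v ∈ A) (hvX : v ∉ X \ XA) : insert v (G.parents v) ⊆ A :=
      Set.insert_subset hv fun u hu => parA hv hvX hu
    have famB {v : V} (hv : v ∈ B) (hvX : v ∉ X \ XB) : insert v (G.parents v) ⊆ B :=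
      Set.insert_subset hv fun u hu => parB hv hvX hu
    have famC {v : V} (hv : v ∈ C) (hvX : v ∉ X \ XC) : insert v (G.parents v) ⊆ C :=
      Set.insert_subset hv fun u hu => parC hv hvX hu
    refine hP.condIndepGiven (Set.disjoint_left.2 fun v hv h => h.2 (.inl hv))
      (Set.disjoint_left.2 fun v hv h => h.2 (.inl hv))
      (Set.disjoint_left.2 fun v hv h => h.2 (.inr hv.1)) fun v hv => ?_
    -- An observable in `A` may have parents outside `A`, so its family is placed through the module
    -- it generates, not the set in which `v` was found.
    by_cases hvX : v ∈ X
    · rcases hX ▸ hvX with (hvA | hvB) | hvC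
      · exact .inl ((famA (hXA hvA) fun h => h.2 hvA).trans Set.subset_union_left)
      · exact .inl ((famB (hXB hvB) fun h => h.2 hvB).trans hBS)
      · exact .inr ((famC (hXC hvC) fun h => h.2 hvC).trans hCT)
    · rcases hv with (hvA | hvB) | hvC
      · exact .inl ((famA hvA fun h => hvX h.1).trans Set.subset_union_left)
      · exact .inl ((famB hvB.1 fun h => hvX h.1).trans hBS)
      · exact .inr ((famC hvC.1 fun h => hvX h.1).trans hCT)
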